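/- Let $S\subset\mathbb{R}$ be a Borel set, let $d\ge 0$ be an integer and $[d]=\{1,\dots,d\}$. For $\omega\in S^d$ and $K\subset[d]$ let $\mathrm{Cyl}(K,\omega)=\{\omega'\in S^d:\ \omega'_i=\omega_i \text{ for all } i\in K\}$, and for $A\subset S^d$ let $[A]_K=\{\omega\in S^d:\ \mathrm{Cyl}(K,\omega)\subset A\}$. For $A,B\subset S^d$ put $$A\,\square\, B=\bigcup_{K\subset[d]}[A]_K\cap[B]_{[d]\setminus K},$$ and for $A_1,\dots,A_r\subset S^d$ put $$\square_{1\le i\le r}A_i=\bigcup_{J_1,\dots,J_r}[A_1]_{J_1}\cap\cdots\cap[A_r]_{J_r},$$ the union being over all pairwise disjoint $J_1,\dots,J_r\subset[d]$. Let $\mathbb{P}$ be a complete product probability measure on $S^d$, that is, the completion of a product $\mu_1\times\cdots\times\mu_d$ of (not necessarily equal) Borel probability measures on $S$. Then for all Borel subsets $A,B$ of $S^d$ the set $A\,\square\,B$ is $\mathbb{P}$-measurable and $$\mathbb{P}(A\,\square\,B)\le\mathbb{P}(A)\,\mathbb{P}(B),$$ and for every integer $r\ge 0$ and all Borel subsets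 $A_1,\dots,A_r$ of $S^d$ the set $\square_{1\le i\le r}A_i$ is $\mathbb{P}$-measurable and $$\mathbb{P}\Big(\square_{1\le i\le r}A_i\Big)\le\prod_{i=1}^r\mathbb{P}(A_i).$$ -/

import Mathlib

namespace BKR

open MeasureTheory

variable {d : ℕ} {S : Type*}

/-- The thin cylinder `Cyl(K, ω)`: all points of `S^d` that agree with `ω` on the coordinates
in `K`. -/
def thinCyl (K : Set (Fin d)) (ω : Fin d → S) : Set (Fin d → S) :=
  {ω' | ∀ i ∈ K, ω' i = ω i}

/-- `[A]_K`, the largest cylinder contained in `A` that is free in the directions outside `K`. -/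
def maxCyl (A : Set (Fin d → S)) (K : Set (Fin d)) : Set (Fin d → S) :=
  {ω | thinCyl K ω ⊆ A}

/-- The two-event BKR operator: the union over all `K` of `[A]_K ∩ [B]_{Kᶜ}`. -/
def box (A B : Set (Fin d → S)) : Set (Fin d → S) :=
  ⋃ K : Set (Fin d), maxCyl A K ∩ maxCyl B Kᶜ

/-- The simultaneous `r`-event BKR operator: the union over all pairwise disjoint
`J_1, …, J_r` of `[A_1]_{J_1} ∩ ⋯ ∩ [A_r]_{J_r}`. -/
def bigBox {r : ℕ} (A : Fin r → Set (Fin d → S)) : Set (Fin d → S) :=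
  ⋃ (J : Fin r → Set (Fin d)) (_ : ∀ i j, i ≠ j → Disjoint (J i) (J j)),
    ⋂ i, maxCyl (A i) (J i)

/-- The complete product measure on `S^d` with marginals `μ_1, …, μ_d`: the completion of the
product measure on the product sigma-algebra. Its measurable sets are the null-measurable sets
of the product measure. -/
noncomputable def completeProd [MeasurableSpace S] (μ : Fin d → Measure S) :
    Measure (NullMeasurableSpace (Fin d → S) (Measure.pi μ)) :=
  (Measure.pi μ).completion

end BKR

/-! Exchanging coordinates between two independent samples reduces the inequality to counting: for a
fixed pair the swaps form a cube {0,1}^d, on which |A □ B| ≤ |A ∩ B̄|, with B̄ antipodal to B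
(`ncard_box_le`). Integrating over pairs gives `measure_box_le`.

Reimer's count is linear algebra. A point x of A □ B with witness K yields a tensor vector lying in
the span of the all-`true` vectors E_y with y ∈ A, and orthogonal to E_z unless z ∈ B̄. These
vectors are independent (`det_butterflyVec_ne_zero`), and remain so when only their pairings with
E_z, z ∈ A ∩ B̄, are kept.

For measurability, [A]_K is the complement of a projection, so the natural class is that of
coanalytic sets: the operations preserve it and its members are null-measurable. Several events
follow by induction. -/

namespace BKR

open MeasureTheory Set Filter Topology
open scoped ENNReal

/-! ### Reimer's lemma on the discrete cube -/

/-- The coordinate vectors of Reimer's butterflies: `x` selects the standard or the Hadamard basis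
of `ℤ²`, and `k` selects a vector of that basis (the flag `true` gives the first one). -/
def butterflyEntry (x k z : Bool) : ℤ :=
  if x then (if k then 1 else if z then -1 else 1) else (if k = z then 0 else 1)

/-- The coefficients of `butterflyEntry x k` in the basis `butterflyEntry · true`. -/
def butterflyCoeff (x k y : Bool) : ℤ :=
  if k then (if x = y then 1 else 0)
  else if x then (if y then -1 else 2) else (if y then 1 else -1)

/-- The tensor product over all coordinates of the vectors `butterflyEntry (x i) (κ i)`. -/
def butterflyVec {d : ℕ} (κ x z : Fin d → Bool) : ℤ :=
  ∏ i, butterflyEntry (x i) (κ i) (z i)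

theorem butterflyEntry_eq_sum (x k z : Bool) :
    butterflyEntry x k z = ∑ y, butterflyCoeff x k y * butterflyEntry y true z := by
  revert x k z; decide

theorem butterflyVec_eq_sum {d : ℕ} (κ x z : Fin d → Bool) :
    butterflyVec κ x z =
      ∑ y : Fin d → Bool, (∏ i, butterflyCoeff (x i) (κ i) (y i)) *
        butterflyVec (fun _ => true) y z := by
  simp only [butterflyVec, ← Finset.prod_mul_distrib]
  rw [← Fintype.prod_sum (fun i y => butterflyCoeff (x i) (κ i) y * butterflyEntry y true (z i))]
  exact Finset.prod_congr rfl fun i _ => butterflyEntry_eq_sum _ _ _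

/-- This confines the expansion of a butterfly vector to points agreeing with x on K, which lie in A
when x ∈ [A]_K. -/
theorem eq_of_prod_butterflyCoeff_ne_zero {d : ℕ} {κ x y : Fin d → Bool}
    (h : ∏ i, butterflyCoeff (x i) (κ i) (y i) ≠ 0) (i : Fin d) (hi : κ i = true) :
    y i = x i := by
  have := Finset.prod_ne_zero_iff.1 h i (Finset.mem_univ i)
  rw [hi] at this
  revert this
  generalize x i = a
  generalize y i = b
  revert a b; decide

/-- Each of the two bases of ℤ² is orthogonal, so a single coordinate kills the tensor product. -/
theorem sum_butterflyVec_mul_eq_zero {d : ℕ} {κ x y : Fin d → Bool} (i : Fin d)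
    (hi : κ i = false) (hxy : y i = x i) :
    ∑ z, butterflyVec κ x z * butterflyVec (fun _ => true) y z = 0 := by
  simp only [butterflyVec, ← Finset.prod_mul_distrib]
  rw [← Fintype.prod_sum
    (fun i z => butterflyEntry (x i) (κ i) z * butterflyEntry (y i) true z)]
  refine Finset.prod_eq_zero (Finset.mem_univ i) ?_
  rw [hi, hxy]
  generalize x i = a
  revert a; decide

/-- Butterfly vectors of distinct points are linearly independent, because they already are so
modulo two. -/
theorem det_butterflyVec_ne_zero {d : ℕ} (κ : (Fin d → Bool) → Fin d → Bool) :
    (Matrix.of fun x z => butterflyVec (κ x) x z).det ≠ 0 := by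
  intro hdet
  have hdet2 : ((Matrix.of fun x z => butterflyVec (κ x) x z).map
      (Int.castRingHom (ZMod 2))).det = 0 := by
    rw [← RingHom.mapMatrix_apply, ← RingHom.map_det, hdet, map_zero]
  obtain ⟨v, hv, hvM⟩ := Matrix.exists_vecMul_eq_zero_iff.2 hdet2
  obtain ⟨x₁, hx₁⟩ := Function.ne_iff.1 hv
  obtain ⟨x₀, hx₀, hmin⟩ := (Set.toFinite {x | v x ≠ 0}).exists_minimal ⟨x₁, hx₁⟩
  -- Modulo two both vectors for `true` become (1, 1). The functional φ a takes the value 1 on both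
  -- vectors for a, and φ false kills (1, 1). The matrix is thus unitriangular for the product
  -- order, and minimality of x₀ isolates v x₀.
  let φ : Bool → Bool → ZMod 2 := fun a b => if a && b then 0 else 1
  have key : ∀ x, ∑ z : Fin d → Bool, (∏ i, φ (x₀ i) (z i)) *
      ((butterflyVec (κ x) x z : ℤ) : ZMod 2) =
      ∏ i, ∑ b, φ (x₀ i) b * ((butterflyEntry (x i) (κ x i) b : ℤ) : ZMod 2) := by
    intro x
    rw [Fintype.prod_sum]
    simp only [butterflyVec, Int.cast_prod, Finset.prod_mul_distrib]
  have h1 : ∏ i, ∑ b, φ (x₀ i) b * ((butterflyEntry (x₀ i) (κ x₀ i) b : ℤ) : ZMod 2) = 1 := by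
    refine Finset.prod_eq_one fun i _ => ?_
    generalize x₀ i = a
    generalize κ x₀ i = k
    revert a k; decide
  have h0 : ∀ x, x ≠ x₀ → v x ≠ 0 →
      ∏ i, ∑ b, φ (x₀ i) b * ((butterflyEntry (x i) (κ x i) b : ℤ) : ZMod 2) = 0 := by
    intro x hx hvx
    have hle : ¬ x ≤ x₀ := fun h => hx (le_antisymm h (hmin hvx h))
    rw [Pi.le_def] at hle
    push Not at hle
    obtain ⟨i, hi⟩ := hle
    refine Finset.prod_eq_zero (Finset.mem_univ i) ?_
    obtain ⟨ha, hb⟩ := Bool.lt_iff.1 hi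
    rw [ha, hb]
    generalize κ x i = k
    revert k; decide
  have hsum : ∑ z : Fin d → Bool, (∏ i, φ (x₀ i) (z i)) *
      ∑ x, v x * ((butterflyVec (κ x) x z : ℤ) : ZMod 2) = 0 := by
    refine Finset.sum_eq_zero fun z _ => ?_
    have := congrFun hvM z
    simp only [Matrix.vecMul, dotProduct, Matrix.map_apply, Matrix.of_apply, Pi.zero_apply,
      eq_intCast] at this
    rw [this, mul_zero]
  simp only [Finset.mul_sum] at hsum
  rw [Finset.sum_comm] at hsum
  simp only [mul_left_comm _ (v _)] at hsum
  simp only [← Finset.mul_sum, key] at hsum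
  rw [Finset.sum_eq_single x₀, h1, mul_one] at hsum
  · exact hx₀ hsum
  · intro x _ hx
    by_cases hvx : v x = 0
    · rw [hvx, zero_mul]
    · rw [h0 x hx hvx, mul_zero]
  · simp

/-- **Reimer's lemma**: on the discrete cube, `A □ B` has at most as many points as the
intersection of `A` with the antipodal image of `B`. -/
theorem ncard_box_le {d : ℕ} (A B : Set (Fin d → Bool)) :
    (box A B).ncard ≤ (A ∩ {z | (fun i => !z i) ∈ B}).ncard := by
  classical
  -- Off the box the witness ∅ is arbitrary: independence holds for every choice of κ.
  have hK : ∀ x, ∃ K : Set (Fin d), x ∈ box A B → x ∈ maxCyl A K ∧ x ∈ maxCyl B Kᶜ := by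
    intro x
    by_cases hx : x ∈ box A B
    · obtain ⟨K, hK⟩ := Set.mem_iUnion.1 hx
      exact ⟨K, fun _ => hK⟩
    · exact ⟨∅, fun h => absurd h hx⟩
  choose K hK using hK
  let κ : (Fin d → Bool) → Fin d → Bool := fun x i => decide (i ∈ K x)
  let E : (Fin d → Bool) → (Fin d → Bool) → ℤ := butterflyVec fun _ => true
  let g : box A B → (A ∩ {z | (fun i => !z i) ∈ B} : Set (Fin d → Bool)) → ℤ :=
    fun x z => ∑ y, butterflyVec (κ x) x y * E z y
  have hli : LinearIndependent ℤ g := by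
    rw [Fintype.linearIndependent_iff]
    intro α hα
    let v : (Fin d → Bool) → ℤ := fun y => ∑ x : box A B, α x * butterflyVec (κ x) x y
    have hvE : ∀ z ∈ A, ∑ y, v y * E z y = 0 := by
      intro z hz
      have hswap : ∑ y, v y * E z y =
          ∑ x : box A B, α x * ∑ y, butterflyVec (κ x) x y * E z y := by
        simp only [v, Finset.sum_mul, Finset.mul_sum]
        rw [Finset.sum_comm]
        simp only [mul_assoc]
      rw [hswap]
      by_cases hzB : (fun i => !z i) ∈ B
      · have := congrFun hα ⟨z, hz, hzB⟩
        simpa [g, Finset.sum_apply] using this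
      · refine Finset.sum_eq_zero fun x _ => ?_
        have hx := (hK x x.2).2
        have : ∃ i, i ∉ K x ∧ z i = (x : Fin d → Bool) i := by
          by_contra! hne
          refine hzB (hx fun i hi => ?_)
          have := hne i hi
          revert this
          cases z i <;> cases (x : Fin d → Bool) i <;> simp
        obtain ⟨i, hi, hzi⟩ := this
        rw [sum_butterflyVec_mul_eq_zero i (by simpa [κ] using hi) hzi, mul_zero]
    -- v is a combination of the E_y with y ∈ A and is orthogonal to all of them, hence to itself.
    have hvv : ∑ y, v y * v y = 0 := by
      have hxv : ∀ x : box A B, ∑ y, v y * butterflyVec (κ x) x y = 0 := by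
        intro x
        have : ∑ y, v y * butterflyVec (κ x) x y = ∑ z : Fin d → Bool,
            (∏ i, butterflyCoeff ((x : Fin d → Bool) i) (κ x i) (z i)) * ∑ y, v y * E z y := by
          simp only [butterflyVec_eq_sum (κ x), Finset.mul_sum]
          rw [Finset.sum_comm]
          simp only [E, mul_left_comm]
        rw [this]
        refine Finset.sum_eq_zero fun z _ => ?_
        by_cases hc : ∏ i, butterflyCoeff ((x : Fin d → Bool) i) (κ x i) (z i) = 0
        · rw [hc, zero_mul]
        · rw [hvE z, mul_zero]
          exact (hK x x.2).1 fun i hi =>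
            eq_of_prod_butterflyCoeff_ne_zero hc i (by simpa [κ] using hi)
      calc ∑ y, v y * v y
          = ∑ x : box A B, α x * ∑ y, v y * butterflyVec (κ x) x y := by
            conv_lhs => enter [2, y, 2]; simp only [v]
            simp only [Finset.mul_sum]
            rw [Finset.sum_comm]
            simp only [mul_left_comm]
        _ = 0 := Finset.sum_eq_zero fun x _ => by rw [hxv, mul_zero]
    have hv0 : ∀ y, v y = 0 := by
      intro y
      have := (Finset.sum_eq_zero_iff_of_nonneg fun y _ => mul_self_nonneg (v y)).1 hvv y
        (Finset.mem_univ y)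
      exact mul_self_eq_zero.1 this
    by_contra! hne
    obtain ⟨x, hx⟩ := hne
    refine det_butterflyVec_ne_zero κ (Matrix.exists_vecMul_eq_zero_iff.1
      ⟨fun x => if h : x ∈ box A B then α ⟨x, h⟩ else 0, ?_, ?_⟩)
    · intro h
      have := congrFun h x
      simp at this
      exact hx this
    · ext z
      refine Eq.trans ?_ (hv0 z)
      refine (Finset.sum_of_injOn Subtype.val Subtype.val_injective.injOn (by simp) ?_ ?_).symm
      · intro x _ hx
        have : x ∉ box A B := by simpa using hx
        simp [this]
      · simp
  have := hli.fintype_card_le_finrank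
  rwa [Module.finrank_fintype_fun_eq_card, Fintype.card_eq_nat_card, Fintype.card_eq_nat_card,
    Nat.card_coe_set_eq, Nat.card_coe_set_eq] at this

/-! ### Universal measurability of analytic sets -/

theorem isCompact_pi_Iic (b : ℕ → ℕ) : IsCompact {x : ℕ → ℕ | ∀ i, x i ≤ b i} := by
  have := isCompact_univ_pi (X := fun _ : ℕ => ℕ) (s := fun i => Iic (b i))
    fun i => (finite_Iic (b i)).isCompact
  convert this using 1
  ext x; simp [Pi.le_def]

/-- If every initial box of a compact product box in `ℕ^ℕ` meets the preimage of a closed set, then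
so does the product box itself. -/
theorem exists_mem_of_forall_exists_le {C : Set (ℕ → ℕ)} (hC : IsClosed C) {b : ℕ → ℕ}
    (h : ∀ k, ∃ x : ℕ → ℕ, (∀ i < k, x i ≤ b i) ∧ x ∈ C) : ∃ x ∈ C, ∀ i, x i ≤ b i := by
  choose x hx hxC using h
  let y : ℕ → ℕ → ℕ := fun k i => min (x k i) (b i)
  obtain ⟨a, ha, φ, hφ, hlim⟩ := (isCompact_pi_Iic b).tendsto_subseq (x := y)
    fun k i => min_le_right _ _
  refine ⟨a, ?_, ha⟩
  refine hC.mem_of_tendsto (f := fun k => x (φ k)) (b := atTop) ?_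
    (Eventually.of_forall fun k => hxC _)
  rw [tendsto_pi_nhds] at hlim ⊢
  intro i
  refine (hlim i).congr' ?_
  filter_upwards [eventually_gt_atTop i] with k hk
  exact min_eq_left (hx _ i (hk.trans_le (hφ.id_le k)))

/-- An analytic set is approximated from inside by compact sets, with respect to the outer
measure induced by a finite measure. -/
theorem exists_isCompact_lt_of_analyticSet {α : Type*} [TopologicalSpace α] [T2Space α]
    [MeasurableSpace α] [OpensMeasurableSpace α] (μ : Measure α)
    [IsFiniteMeasure μ] {s : Set α} (hs : AnalyticSet s) {r : ℝ≥0∞} (hr : r < μ s) :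
    ∃ K ⊆ s, IsCompact K ∧ r ≤ μ K := by
  rw [AnalyticSet] at hs
  obtain rfl | ⟨f, hf, rfl⟩ := hs
  · simp at hr
  -- Coordinates are bounded one at a time; continuity along increasing unions needs no
  -- measurability of the images.
  have step : ∀ (k : ℕ) (T : Set (ℕ → ℕ)), r < μ (f '' T) →
      ∃ n, r < μ (f '' (T ∩ {x | x k ≤ n})) := by
    intro k T hT
    have hU : f '' T = ⋃ n, f '' (T ∩ {x | x k ≤ n}) := by
      rw [← image_iUnion, ← inter_iUnion]
      congr 1
      refine (inter_eq_left.2 fun x _ => mem_iUnion.2 ⟨x k, le_refl (x k)⟩).symm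
    rw [hU, Monotone.measure_iUnion] at hT
    · exact lt_iSup_iff.1 hT
    · intro m n hmn
      exact image_mono (inter_subset_inter_right _ fun x (hx : x k ≤ m) => hx.trans hmn)
  choose! n hn using step
  let T : ℕ → Set (ℕ → ℕ) := fun k => Nat.rec univ (fun k T => T ∩ {x | x k ≤ n k T}) k
  have hT : ∀ k, r < μ (f '' T k) := by
    intro k
    induction k with
    | zero => simpa [T, image_univ] using hr
    | succ k ih => exact hn k (T k) ih
  let b : ℕ → ℕ := fun k => n k (T k)
  have hTb : ∀ k, T k = {x | ∀ i < k, x i ≤ b i} := by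
    intro k
    induction k with
    | zero => simp [T]
    | succ k ih =>
      have : T (k + 1) = T k ∩ {x | x k ≤ b k} := rfl
      rw [this, ih]
      ext x
      simp only [mem_inter_iff, mem_ofPred_eq, Nat.lt_succ_iff_lt_or_eq, or_imp, forall_and,
        forall_eq]
  let L : Set (ℕ → ℕ) := {x | ∀ i, x i ≤ b i}
  have hL : IsCompact (f '' L) := (isCompact_pi_Iic b).image hf
  refine ⟨f '' L, image_subset_range _ _, hL, ?_⟩
  -- Continuity from above does need measurability, hence the closures.
  have hanti : Antitone fun k => closure (f '' T k) := by
    refine antitone_nat_of_succ_le fun k => closure_mono (image_mono ?_)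
    exact inter_subset_left
  have hInter : ⋂ k, closure (f '' T k) ⊆ f '' L := by
    intro y hy
    by_contra hyL
    obtain ⟨U, V, hU, hV, hyU, hLV, hUV⟩ := SeparatedNhds.of_isCompact_isCompact
      isCompact_singleton hL (disjoint_singleton_left.2 hyL)
    obtain ⟨x, hxC, hxb⟩ := exists_mem_of_forall_exists_le (hV.isClosed_compl.preimage hf)
      (b := b) fun k => by
        obtain ⟨w, hwU, x, hx, rfl⟩ := mem_closure_iff.1 (mem_iInter.1 hy k) U hU
          (hyU rfl)
        rw [hTb] at hx
        exact ⟨x, hx, fun h => disjoint_left.1 hUV hwU h⟩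
    exact hxC (hLV ⟨x, hxb, rfl⟩)
  calc r ≤ ⨅ k, μ (closure (f '' T k)) :=
        le_iInf fun k => (hT k).le.trans (measure_mono subset_closure)
    _ = μ (⋂ k, closure (f '' T k)) :=
        (hanti.measure_iInter (fun k => isClosed_closure.nullMeasurableSet)
          ⟨0, measure_ne_top _ _⟩).symm
    _ ≤ μ (f '' L) := measure_mono hInter

/-- **Universal measurability** of analytic sets. -/
theorem nullMeasurableSet_of_analyticSet {α : Type*} [TopologicalSpace α] [T2Space α]
    [MeasurableSpace α] [OpensMeasurableSpace α] (μ : Measure α)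
    [IsFiniteMeasure μ] {s : Set α} (hs : AnalyticSet s) : NullMeasurableSet s μ := by
  have hK : ∀ n : ℕ, ∃ K ⊆ s, IsCompact K ∧ μ s ≤ μ K + (n + 1 : ℝ≥0∞)⁻¹ := by
    intro n
    by_cases h0 : μ s = 0
    · exact ⟨∅, empty_subset _, isCompact_empty, by simp [h0]⟩
    · obtain ⟨K, hKs, hK, hle⟩ := exists_isCompact_lt_of_analyticSet μ hs
        (ENNReal.sub_lt_self (measure_ne_top μ s) h0
          (ENNReal.inv_ne_zero.2 (by finiteness : (n + 1 : ℝ≥0∞) ≠ ⊤)))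
      exact ⟨K, hKs, hK, tsub_le_iff_right.1 hle⟩
  choose K hKs hK hle using hK
  let t := ⋃ n, K n
  have ht : MeasurableSet t := MeasurableSet.iUnion fun n => (hK n).measurableSet
  have hts : t ⊆ s := iUnion_subset hKs
  have hle' : μ s ≤ μ t := by
    refine ENNReal.le_of_forall_pos_le_add fun ε hε _ => ?_
    obtain ⟨n, hn⟩ := ENNReal.exists_inv_nat_lt (ENNReal.coe_pos.2 hε).ne'
    calc μ s ≤ μ (K n) + (n + 1 : ℝ≥0∞)⁻¹ := hle n
      _ ≤ μ t + ε := by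
        gcongr
        · exact subset_iUnion K n
        · exact (ENNReal.inv_le_inv.2 le_self_add).trans hn.le
  exact ⟨t, ht, (ae_eq_of_subset_of_measure_ge hts hle' ht.nullMeasurableSet
    (measure_ne_top _ _)).symm⟩

/-! ### Coanalytic sets and the BKR operations -/

/-- The complements of analytic sets; they are stable under the BKR operations. -/
def Coanalytic {α : Type*} [TopologicalSpace α] (s : Set α) : Prop := AnalyticSet sᶜ

namespace Coanalytic

variable {α : Type*} [TopologicalSpace α] {ι : Type*} [Countable ι]

theorem iUnion [T2Space α] [Nonempty ι] {s : ι → Set α} (hs : ∀ i, Coanalytic (s i)) :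
    Coanalytic (⋃ i, s i) := by
  rw [Coanalytic, compl_iUnion]
  exact AnalyticSet.iInter hs

theorem iInter {s : ι → Set α} (hs : ∀ i, Coanalytic (s i)) : Coanalytic (⋂ i, s i) := by
  rw [Coanalytic, compl_iInter]
  exact AnalyticSet.iUnion hs

theorem inter {s t : Set α} (hs : Coanalytic s) (ht : Coanalytic t) : Coanalytic (s ∩ t) := by
  rw [inter_eq_iInter]
  exact iInter fun b => by cases b <;> assumption

theorem nullMeasurableSet [T2Space α] [MeasurableSpace α] [OpensMeasurableSpace α] (μ : Measure α)
    [IsFiniteMeasure μ] {s : Set α} (hs : Coanalytic s) : NullMeasurableSet s μ :=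
  (nullMeasurableSet_of_analyticSet μ hs).of_compl

end Coanalytic

variable {S : Type*} [TopologicalSpace S] [PolishSpace S]

/-- Leaving [A]_K means having a bad point with the same K-coordinates, so the complement is the
image of Aᶜ × S^d under continuous gluing along K. -/
theorem Coanalytic.maxCyl {d : ℕ} {A : Set (Fin d → S)} (hA : Coanalytic A) (K : Set (Fin d)) :
    Coanalytic (maxCyl A K) := by
  classical
  have hglue : Continuous fun p : (Fin d → S) × (Fin d → S) => K.piecewise p.1 p.2 := by
    refine continuous_pi fun i => ?_
    by_cases hi : i ∈ K <;> simp only [Set.piecewise, hi, if_true, if_false] <;> fun_prop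
  have : (BKR.maxCyl A K)ᶜ = (fun p : (Fin d → S) × (Fin d → S) => K.piecewise p.1 p.2) ''
      (Prod.fst ⁻¹' Aᶜ) := by
    ext ω
    simp only [BKR.maxCyl, thinCyl, mem_compl_iff, mem_ofPred_eq, not_subset, mem_image,
      mem_preimage, Prod.exists]
    constructor
    · rintro ⟨ω', h, hA⟩
      refine ⟨ω', ω, hA, ?_⟩
      ext i
      by_cases hi : i ∈ K <;> simp [hi, h]
    · rintro ⟨ω', η, hA, rfl⟩
      exact ⟨ω', fun i hi => by simp [hi], hA⟩
  rw [Coanalytic, this]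
  exact (AnalyticSet.preimage hA continuous_fst).image_of_continuous hglue

theorem Coanalytic.box {d : ℕ} {A B : Set (Fin d → S)} (hA : Coanalytic A) (hB : Coanalytic B) :
    Coanalytic (box A B) :=
  Coanalytic.iUnion fun K => (hA.maxCyl K).inter (hB.maxCyl Kᶜ)

theorem Coanalytic.bigBox {d r : ℕ} {A : Fin r → Set (Fin d → S)} (hA : ∀ i, Coanalytic (A i)) :
    Coanalytic (bigBox A) := by
  have : BKR.bigBox A =
      ⋃ J : {J : Fin r → Set (Fin d) // ∀ i j, i ≠ j → Disjoint (J i) (J j)},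
        ⋂ i, BKR.maxCyl (A i) (J.1 i) := by
    rw [BKR.bigBox, iUnion_subtype]
  rw [this]
  have : Nonempty {J : Fin r → Set (Fin d) // ∀ i j, i ≠ j → Disjoint (J i) (J j)} :=
    ⟨⟨fun _ => ∅, fun _ _ _ => disjoint_bot_left⟩⟩
  exact Coanalytic.iUnion fun J => Coanalytic.iInter fun i => (hA i).maxCyl _

/-! ### Symmetrisation and the two-event inequality -/

/-- Exchange the coordinates selected by `z` between two points of `S^d`. -/
def swapCoords {d : ℕ} {S : Type*} (z : Fin d → Bool) (p : (Fin d → S) × (Fin d → S)) :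
    (Fin d → S) × (Fin d → S) :=
  (fun i => if z i then p.2 i else p.1 i, fun i => if z i then p.1 i else p.2 i)

/-- This turns the antipode in Reimer's lemma into the second, independent sample. -/
theorem swapCoords_snd {d : ℕ} {S : Type*} (z : Fin d → Bool) (p : (Fin d → S) × (Fin d → S)) :
    (swapCoords z p).2 = (swapCoords (fun i => !z i) p).1 := by
  ext i
  cases h : z i <;> simp [swapCoords, h]

/-- Under (S^d)² ≃ (S²)^d the swap acts coordinatewise, and each μ_i × μ_i is symmetric. -/
theorem measurePreserving_swapCoords {d : ℕ} {S : Type*} [MeasurableSpace S]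
    (μ : Fin d → Measure S) [∀ i, SigmaFinite (μ i)] (z : Fin d → Bool) :
    MeasurePreserving (swapCoords z) ((Measure.pi μ).prod (Measure.pi μ))
      ((Measure.pi μ).prod (Measure.pi μ)) := by
  have he := measurePreserving_arrowProdEquivProdArrow S S (Fin d) μ μ
  have hf : MeasurePreserving (fun (a : Fin d → S × S) i => (if z i then Prod.swap else id) (a i))
      (Measure.pi fun i => (μ i).prod (μ i)) (Measure.pi fun i => (μ i).prod (μ i)) := by
    refine measurePreserving_pi _ _ fun i => ?_
    split_ifs
    · exact Measure.measurePreserving_swap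
    · exact MeasurePreserving.id _
  convert he.comp (hf.comp he.symm) using 1
  ext p i
  · cases h : z i <;>
      simp [swapCoords, MeasurableEquiv.arrowProdEquivProdArrow, Equiv.arrowProdEquivProdArrow, h]
  · cases h : z i <;>
      simp [swapCoords, MeasurableEquiv.arrowProdEquivProdArrow, Equiv.arrowProdEquivProdArrow, h]

theorem box_swapCoords_subset {d : ℕ} {S : Type*} (A B : Set (Fin d → S))
    (p : (Fin d → S) × (Fin d → S)) :
    {z | (swapCoords z p).1 ∈ box A B} ⊆
      box {z | (swapCoords z p).1 ∈ A} {z | (swapCoords z p).1 ∈ B} := by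
  intro z hz
  obtain ⟨K, hA, hB⟩ := mem_iUnion.1 hz
  refine mem_iUnion.2 ⟨K, fun z' hz' => hA fun i hi => ?_, fun z' hz' => hB fun i hi => ?_⟩ <;>
  simp [swapCoords, hz' i hi]

theorem sum_measure_eq_lintegral_ncard {α ι : Type*} [Fintype ι] [MeasurableSpace α]
    {ν : Measure α} {s : ι → Set α} (hs : ∀ i, NullMeasurableSet (s i) ν) :
    ∑ i, ν (s i) = ∫⁻ p, (({i | p ∈ s i}.ncard : ℕ) : ℝ≥0∞) ∂ν := by
  classical
  have h : ∀ p, (({i | p ∈ s i}.ncard : ℕ) : ℝ≥0∞) = ∑ i, (s i).indicator 1 p := by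
    intro p
    simp [ncard_eq_toFinset_card', indicator_apply]
  simp only [h]
  rw [lintegral_finsetSum' (f := fun i => (s i).indicator 1) _ fun i _ =>
    aemeasurable_one.indicator₀ (hs i)]
  exact Finset.sum_congr rfl fun i _ => (lintegral_indicator_one₀ (hs i)).symm

/-- The two-event inequality for null-measurable sets whose box is null-measurable. -/
theorem measure_box_le {d : ℕ} {S : Type*} [MeasurableSpace S] (μ : Fin d → Measure S)
    [∀ i, IsProbabilityMeasure (μ i)] {A B : Set (Fin d → S)}
    (hA : NullMeasurableSet A (Measure.pi μ)) (hB : NullMeasurableSet B (Measure.pi μ))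
    (hbox : NullMeasurableSet (box A B) (Measure.pi μ)) :
    Measure.pi μ (box A B) ≤ Measure.pi μ A * Measure.pi μ B := by
  set P := Measure.pi μ
  have hmp := measurePreserving_swapCoords μ
  have hC := hbox.prod (ν := P) nullMeasurableSet_univ
  have hAB := hA.prod hB
  have h1 : ∑ z : Fin d → Bool, (P.prod P) (swapCoords z ⁻¹' (box A B ×ˢ univ)) =
      2 ^ d * P (box A B) := by
    simp [(hmp _).measure_preimage hC, P]
  have h2 : ∑ z : Fin d → Bool, (P.prod P) (swapCoords z ⁻¹' (A ×ˢ B)) =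
      2 ^ d * (P A * P B) := by
    simp [(hmp _).measure_preimage hAB, P]
  rw [sum_measure_eq_lintegral_ncard fun z => hC.preimage (hmp z).quasiMeasurePreserving] at h1
  rw [sum_measure_eq_lintegral_ncard fun z => hAB.preimage (hmp z).quasiMeasurePreserving] at h2
  rw [← ENNReal.mul_le_mul_iff_right (a := 2 ^ d) (by simp) (by finiteness), ← h1, ← h2]
  refine lintegral_mono fun p => Nat.cast_le.2 ?_
  calc {z | p ∈ swapCoords z ⁻¹' (box A B ×ˢ univ)}.ncard
      ≤ (box {z | (swapCoords z p).1 ∈ A} {z | (swapCoords z p).1 ∈ B}).ncard :=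
        ncard_le_ncard (fun z hz => box_swapCoords_subset A B p hz.1) (toFinite _)
    _ ≤ _ := ncard_box_le _ _
    _ = {z | p ∈ swapCoords z ⁻¹' (A ×ˢ B)}.ncard := by
        congr 1
        ext z
        simp [swapCoords_snd]

/-! ### Several events -/

theorem bigBox_succ_subset {d r : ℕ} {S : Type*} (A : Fin (r + 1) → Set (Fin d → S)) :
    bigBox A ⊆ box (A 0) (bigBox fun i => A i.succ) := by
  intro ω hω
  simp only [bigBox, mem_iUnion, mem_iInter] at hω
  obtain ⟨J, hJ, hω⟩ := hω
  refine mem_iUnion.2 ⟨J 0, hω 0, fun ω' hω' => ?_⟩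
  simp only [bigBox, mem_iUnion, mem_iInter]
  refine ⟨fun i => J i.succ, fun i j hij => hJ _ _ (by simpa using hij), fun i η hη => ?_⟩
  -- The later index sets avoid J 0, so changing ω on J 0 preserves their cylinders.
  refine hω i.succ fun k hk => (hη k hk).trans (hω' k ?_)
  exact disjoint_left.1 (hJ _ _ (Fin.succ_ne_zero i)) hk

/-- The induction runs over coanalytic sets because the box of the tail is only known to be
coanalytic, even for Borel events. -/
theorem measure_bigBox_le {S : Type*} [TopologicalSpace S] [PolishSpace S] [MeasurableSpace S]
    [BorelSpace S] {d r : ℕ} (μ : Fin d → Measure S) [∀ i, IsProbabilityMeasure (μ i)]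
    {A : Fin r → Set (Fin d → S)} (hA : ∀ i, Coanalytic (A i)) :
    Measure.pi μ (bigBox A) ≤ ∏ i, Measure.pi μ (A i) := by
  induction r with
  | zero => simpa using prob_le_one
  | succ r ih =>
    have hT : Coanalytic (bigBox fun i => A i.succ) := Coanalytic.bigBox fun i => hA i.succ
    calc Measure.pi μ (bigBox A)
        ≤ Measure.pi μ (box (A 0) (bigBox fun i => A i.succ)) :=
          measure_mono (bigBox_succ_subset A)
      _ ≤ Measure.pi μ (A 0) * Measure.pi μ (bigBox fun i => A i.succ) :=
          measure_box_le μ ((hA 0).nullMeasurableSet _) (hT.nullMeasurableSet _)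
            (((hA 0).box hT).nullMeasurableSet _)
      _ ≤ Measure.pi μ (A 0) * ∏ i : Fin r, Measure.pi μ (A i.succ) := by
          gcongr
          exact ih fun i => hA i.succ
      _ = ∏ i, Measure.pi μ (A i) := (Fin.prod_univ_succ fun i => Measure.pi μ (A i)).symm

/-- The van den Berg–Kesten–Reimer inequality for measurable sets in standard Borel spaces. -/
theorem bkr_of_measurableSet {S : Type*} [MeasurableSpace S] [StandardBorelSpace S] {d : ℕ} (μ : Fin d → Measure S)
    [∀ i, IsProbabilityMeasure (μ i)] :
    (∀ A B : Set (Fin d → S), MeasurableSet A → MeasurableSet B →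
      NullMeasurableSet (box A B) (Measure.pi μ) ∧
      Measure.pi μ (box A B) ≤ Measure.pi μ A * Measure.pi μ B) ∧
    (∀ (r : ℕ) (A : Fin r → Set (Fin d → S)), (∀ i, MeasurableSet (A i)) →
      NullMeasurableSet (bigBox A) (Measure.pi μ) ∧
      Measure.pi μ (bigBox A) ≤ ∏ i, Measure.pi μ (A i)) := by
  let := upgradeStandardBorel S
  have hco : ∀ A : Set (Fin d → S), MeasurableSet A → Coanalytic A :=
    fun A hA => hA.compl.analyticSet
  refine ⟨fun A B hA hB => ?_, fun r A hA => ?_⟩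
  · have hbox := ((hco A hA).box (hco B hB)).nullMeasurableSet (Measure.pi μ)
    exact ⟨hbox, measure_box_le μ hA.nullMeasurableSet hB.nullMeasurableSet hbox⟩
  · exact ⟨(Coanalytic.bigBox fun i => hco _ (hA i)).nullMeasurableSet _,
      measure_bigBox_le μ fun i => hco _ (hA i)⟩

end BKR

theorem mainTheorem7 (S : Set ℝ) (hS : MeasurableSet S) (d : ℕ)
    (μ : Fin d → MeasureTheory.Measure S)
    (hμ : ∀ i, MeasureTheory.IsProbabilityMeasure (μ i)) :
    (∀ A B : Set (Fin d → S), MeasurableSet A → MeasurableSet B →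
      MeasureTheory.NullMeasurableSet (BKR.box A B) (MeasureTheory.Measure.pi μ) ∧
      BKR.completeProd μ (BKR.box A B) ≤ BKR.completeProd μ A * BKR.completeProd μ B) ∧
    (∀ (r : ℕ) (A : Fin r → Set (Fin d → S)), (∀ i, MeasurableSet (A i)) →
      MeasureTheory.NullMeasurableSet (BKR.bigBox A) (MeasureTheory.Measure.pi μ) ∧
      BKR.completeProd μ (BKR.bigBox A) ≤ ∏ i, BKR.completeProd μ (A i)) := by
  have := hS.standardBorel
  -- By definition the completion has the same values as the product measure.
  exact BKR.bkr_of_measurableSet μ
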